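/- Let $m, L, N_0, n_1,\dots,n_L$ be nonnegative integers, let $d_1,\dots,d_L\ge 1$, let $\sigma\ge 0$, and for $l=1,\dots,L$ let $U^{(l)}\in\mathbb R^{m\times d_l}$ be a deterministic matrix with orthonormal columns, with column space $\mathcal S_l$. Let the data set $\mathcal X$ consist of $N=N_0+\sum_{l} n_l$ points of $\mathbb R^m$: $N_0$ outliers, drawn i.i.d. $\mathcal N(0,\tfrac1m I)$, and, for each $l$, the $n_l$ inliers $$x^{(l)}_j=\frac{1}{\sqrt{1+\sigma^2}}\bigl(U^{(l)}a^{(l)}_j+e^{(l)}_j\bigr),\qquad j=1,\dots,n_l,$$ belonging to $\mathcal S_l$, where $a^{(l)}_j$ is uniformly distributed on the unit sphere of $\mathbb R^{d_l}$, $e^{(l)}_j\sim\mathcal N(0,\tfrac{\sigma^2}{m}I)$, and all the vectors $a^{(l)}_j$, $e^{(l)}_j$ and all the outliers are independent. Declare a point $x_j\in\mathcal X$ to be an outlier if $$\max_{p\ne j}|\langle x_p,x_j\rangle|<\frac{c\sqrt{\log N}}{\sqrt m},\qquad c=2.3\sqrt6 .$$ There is an absolute constant $c_1>0$ such that the following two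 statements hold for all such data. (i) If $m\ge 6\log N$, then with probability at least $1-3\frac{N_0}{N^2}$ every outlier is detected, that is, all $N_0$ outliers are declared outliers. (ii) If, with $d_{\max}=\max_l d_l$, $$\frac{d_{\max}}{m}\le\frac{c_1}{(1+\sigma^2)^2\log N},$$ then for each $l\in\{1,\dots,L\}$, with probability at least $$1-n_l\Bigl(e^{-\frac12\log(\frac\pi2)(n_l-1)}+n_l\frac{7}{N^3}\Bigr),$$ no inlier belonging to $\mathcal S_l$ is declared an outlier. -/

import Mathlib

open MeasureTheory ProbabilityTheory

/-- The ambient space `ℝ^k` with the Euclidean norm and inner product. -/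
abbrev Vec (k : ℕ) : Type := EuclideanSpace ℝ (Fin k)

/-- The Gaussian law `N(0, s I)` on `ℝ^k`. -/
noncomputable def isoGaussian (k : ℕ) (s : ℝ) : Measure (Vec k) :=
  multivariateGaussian 0 (s • (1 : Matrix (Fin k) (Fin k) ℝ))

/-- The uniform law on the unit sphere of `ℝ^k` (the normalized surface measure), as a measure
on `ℝ^k`. -/
noncomputable def uniformSphere (k : ℕ) : Measure (Vec k) :=
  (((volume : Measure (Vec k)).toSphere Set.univ)⁻¹ • (volume : Measure (Vec k)).toSphere).map
    Subtype.val

/-- The index set of the data: `N₀` outliers, and `n l` inliers for the `l`-th subspace. -/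
abbrev DataIndex {L : ℕ} (N₀ : ℕ) (n : Fin L → ℕ) : Type := Fin N₀ ⊕ (Σ l : Fin L, Fin (n l))

/-- The number of data points, `N = N₀ + ∑ l, n l`. -/
def numPoints {L : ℕ} (N₀ : ℕ) (n : Fin L → ℕ) : ℕ := N₀ + ∑ l, n l

/-- The random ingredients of the data set: the outliers, the coefficient vectors `a l j ∈ ℝ^(d l)`
and the noise vectors `e l j ∈ ℝ^m`. -/
abbrev Ingredients (m : ℕ) {L : ℕ} (N₀ : ℕ) (d n : Fin L → ℕ) : Type :=
  (Fin N₀ → Vec m) × ((l : Fin L) → Fin (n l) → Vec (d l)) × ((l : Fin L) → Fin (n l) → Vec m)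

/-- The joint law of the ingredients: all the vectors are independent, the outliers are
`N(0, (1/m) I)`, the `a l j` are uniform on the unit sphere of `ℝ^(d l)`, and the `e l j` are
`N(0, (σ²/m) I)`. -/
noncomputable def ingredientsLaw (m : ℕ) {L : ℕ} (N₀ : ℕ) (d n : Fin L → ℕ) (σ : ℝ) :
    Measure (Ingredients m N₀ d n) :=
  (Measure.pi fun _ : Fin N₀ => isoGaussian m (1 / m)).prod
    ((Measure.pi fun l : Fin L => Measure.pi fun _ : Fin (n l) => uniformSphere (d l)).prod
      (Measure.pi fun l : Fin L => Measure.pi fun _ : Fin (n l) => isoGaussian m (σ ^ 2 / m)))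

/-- The data points: the outliers themselves, and the normalized noisy inliers
`(U l * a l j + e l j) / √(1 + σ²)`. -/
noncomputable def dataPoint {m L N₀ : ℕ} {d n : Fin L → ℕ}
    (U : (l : Fin L) → Matrix (Fin m) (Fin (d l)) ℝ) (σ : ℝ)
    (o : Fin N₀ → Vec m) (a : (l : Fin L) → Fin (n l) → Vec (d l))
    (e : (l : Fin L) → Fin (n l) → Vec m) : DataIndex N₀ n → Vec m
  | .inl i => o i
  | .inr ⟨l, j⟩ => (1 / √(1 + σ ^ 2)) • (WithLp.toLp 2 ((U l).mulVec (a l j).ofLp) + e l j)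

/-- The detection rule with constant `c`: in a family `x` of `N` vectors of `ℝ^m`, the vector `x j`
is declared an outlier if `max_{p ≠ j} |⟨x p, x j⟩| < c √(log N) / √m`. -/
def DeclaredOutlier {ι : Type} [Fintype ι] {m : ℕ} (c : ℝ) (x : ι → Vec m) (j : ι) : Prop :=
  ∀ p, p ≠ j → |inner ℝ (x p) (x j)| < c * √(Real.log (Fintype.card ι)) / √m

/-! Every bound comes from a Gaussian vector paired with an independent vector `y`: with `y` fixed,
the inner product is a centred real Gaussian of scale proportional to `‖y‖`. Deviations of `√(6 log
N)` scales have probability at most `2/N³`. When `m ≥ 6 log N`, a Chernoff bound for the norm shows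
that `y` is too long with probability at most `1/N³`.

(i) Each outlier thus correlates with each other point above the threshold with probability at most
`3/N³`, and there are at most `N₀ N` pairs (`outlier_inner_tail`).

(ii) Up to the factor `1 + σ²`, the inner product of two inliers of one subspace is `⟪a_p, a_j⟫`
plus three noise terms, controlled in the same way (`noise_tail`). A uniform unit vector is the
direction of a standard Gaussian, so a fixed coordinate is below `1/(10√d)` with probability at most
`√(2/π)` (`uniformSphere_small_ball`). Given `a_j`, the other coefficients are independent, so all
of them are nearly orthogonal to `a_j` with probability at most `√(2/π)^(n-1)`, which is the
exponential in the statement. Otherwise some `p` has a main term that, by the dimension condition,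
dominates noise and threshold (`le_abs_inner_inliers`). -/

/-! ### Standard Gaussian: density, tails, uniformity of the direction. -/

section Gaussian

open Real Module
open scoped RealInnerProductSpace ENNReal

variable {E : Type*} [NormedAddCommGroup E] [InnerProductSpace ℝ E] [FiniteDimensional ℝ E]
  [MeasurableSpace E] [BorelSpace E]

/-- The standard Gaussian measure on a Euclidean space has density
`(2π)^(-dim/2) * exp (-‖x‖² / 2)`. -/
theorem stdGaussian_eq_withDensity :
    stdGaussian E = (volume : Measure E).withDensity fun x =>
      ENNReal.ofReal ((2 * π) ^ (-(finrank ℝ E / 2 : ℝ)) * rexp (-(1 / 2) * ‖x‖ ^ 2)) := by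
  have hint : Integrable
      (fun x : E => (2 * π) ^ (-(finrank ℝ E / 2 : ℝ)) * rexp (-(1 / 2) * ‖x‖ ^ 2)) := by
    refine Integrable.const_mul ?_ _
    refine Integrable.of_integral_ne_zero ?_
    rw [GaussianFourier.integral_rexp_neg_mul_sq_norm (by norm_num)]
    positivity
  have : IsFiniteMeasure ((volume : Measure E).withDensity fun x =>
      ENNReal.ofReal ((2 * π) ^ (-(finrank ℝ E / 2 : ℝ)) * rexp (-(1 / 2) * ‖x‖ ^ 2))) :=
    isFiniteMeasure_withDensity_ofReal hint.2
  refine Measure.ext_of_charFun (funext fun t => ?_)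
  rw [charFun_stdGaussian, charFun_apply, integral_withDensity_eq_integral_toReal_smul
    (by fun_prop) (by simp)]
  have h := GaussianFourier.integral_cexp_neg_mul_sq_norm_add (V := E) (b := 1 / 2)
    (by norm_num) Complex.I t
  calc Complex.exp (-‖t‖ ^ 2 / 2)
      = ((2 * π) ^ (-(finrank ℝ E / 2 : ℝ)) : ℝ) *
        ((π / (1 / 2)) ^ (finrank ℝ E / 2 : ℂ) *
          Complex.exp (Complex.I ^ 2 * ‖t‖ ^ 2 / (4 * (1 / 2)))) := by
        have h1 : ((π : ℂ) / (1 / 2)) ^ (finrank ℝ E / 2 : ℂ)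
            = (((2 * π) ^ (finrank ℝ E / 2 : ℝ) : ℝ) : ℂ) := by
          rw [Complex.ofReal_cpow (by positivity)]
          push_cast
          congr 1
          ring
        rw [h1, ← mul_assoc, ← Complex.ofReal_mul, ← Real.rpow_add (by positivity)]
        rw [neg_add_cancel, Real.rpow_zero, Complex.I_sq]
        push_cast
        rw [one_mul]
        congr 1
        ring
    _ = _ := by
        rw [← h, ← integral_const_mul]
        refine integral_congr_ae (Filter.Eventually.of_forall fun x => ?_)
        simp only
        rw [ENNReal.toReal_ofReal (by positivity), Complex.exp_add, real_inner_comm]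
        rw [Complex.real_smul]
        push_cast
        rw [mul_comm Complex.I, mul_assoc]

/-- Chernoff bound for the norm of a standard Gaussian vector. -/
theorem stdGaussian_norm_tail {R : ℝ} (hR : 0 ≤ R) :
    stdGaussian E {g | R * √(finrank ℝ E) < ‖g‖} ≤
      ENNReal.ofReal (rexp (finrank ℝ E * (log 2 / 2 - R ^ 2 / 4))) := by
  have hm : MeasurableSet {g : E | R * √(finrank ℝ E) < ‖g‖} :=
    measurableSet_lt measurable_const measurable_norm
  rw [stdGaussian_eq_withDensity, withDensity_apply _ hm]
  set k : ℝ := (finrank ℝ E : ℝ) with hk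
  have hk0 : 0 ≤ k := Nat.cast_nonneg _
  have hint : Integrable (fun x : E => rexp (-(1 / 4) * ‖x‖ ^ 2)) := by
    refine Integrable.of_integral_ne_zero ?_
    rw [GaussianFourier.integral_rexp_neg_mul_sq_norm (by norm_num)]
    positivity
  -- Half of the exponent is bounded on the event by `exp(-R²k/4)`. The other half integrates to
  -- `(4π)^(k/2)`, and the ratio `2^(k/2)` to the normalization is the `log 2 / 2` of the bound.
  calc ∫⁻ x in {g : E | R * √k < ‖g‖}, ENNReal.ofReal
        ((2 * π) ^ (-(k / 2)) * rexp (-(1 / 2) * ‖x‖ ^ 2))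
      ≤ ∫⁻ x in {g : E | R * √k < ‖g‖}, ENNReal.ofReal
        ((2 * π) ^ (-(k / 2)) * rexp (-(R ^ 2 * k / 4)) * rexp (-(1 / 4) * ‖x‖ ^ 2)) := by
        refine setLIntegral_mono' hm fun x hx => ENNReal.ofReal_le_ofReal ?_
        rw [mul_assoc, ← Real.exp_add]
        gcongr
        have h1 : (R * √k) ^ 2 ≤ ‖x‖ ^ 2 := by
          have := Set.mem_ofPred_eq ▸ hx
          gcongr
        rw [mul_pow, sq_sqrt hk0] at h1
        linarith
    _ ≤ ∫⁻ x : E, ENNReal.ofReal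
        ((2 * π) ^ (-(k / 2)) * rexp (-(R ^ 2 * k / 4)) * rexp (-(1 / 4) * ‖x‖ ^ 2)) :=
        setLIntegral_le_lintegral _ _
    _ = ENNReal.ofReal (rexp (k * (log 2 / 2 - R ^ 2 / 4))) := by
        rw [← ofReal_integral_eq_lintegral_ofReal (hint.const_mul _)
          (Filter.Eventually.of_forall fun x => by positivity), integral_const_mul,
          GaussianFourier.integral_rexp_neg_mul_sq_norm (by norm_num), ← hk]
        congr 1
        have h2 : (π / (1 / 4)) ^ (k / 2) = (2 * π) ^ (k / 2) * rexp (k * (log 2 / 2)) := by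
          rw [show π / (1 / 4) = (2 * π) * 2 by ring, mul_rpow (by positivity) (by norm_num),
            Real.rpow_def_of_pos (x := 2) (by norm_num)]
          congr 2
          ring
        rw [h2, Real.rpow_neg (by positivity)]
        have h3 : (2 * π) ^ (k / 2) ≠ 0 := by positivity
        rw [show k * (log 2 / 2 - R ^ 2 / 4) = -(R ^ 2 * k / 4) + k * (log 2 / 2) by ring,
          Real.exp_add]
        field_simp

theorem stdGaussian_map_inner (y : E) :
    (stdGaussian E).map (fun g => ⟪g, y⟫) = gaussianReal 0 (‖y‖ ^ 2).toNNReal := by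
  have h := IsGaussian.map_eq_gaussianReal (μ := stdGaussian E) (innerSL ℝ y)
  rw [integral_strongDual_stdGaussian, variance_dual_stdGaussian, innerSL_apply_norm] at h
  rw [← h]
  congr 1
  ext g
  simp [real_inner_comm]

/-- Two-sided Gaussian tail bound for a linear functional of a standard Gaussian vector. -/
theorem stdGaussian_inner_tail (y : E) {R t : ℝ} (ht : 0 ≤ t) (hy : ‖y‖ ≤ R) :
    stdGaussian E {g | t * R < |⟪g, y⟫|} ≤ ENNReal.ofReal (2 * rexp (-(t ^ 2 / 2))) := by
  -- The Chernoff parameter below is `t / ‖y‖`, so `y = 0` is separate; there the strict inequality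
  -- makes the event empty.
  rcases eq_or_ne y 0 with rfl | hy0
  · have : {g : E | t * R < |⟪g, (0 : E)⟫|} = ∅ := by
      ext g
      have : 0 ≤ t * R := mul_nonneg ht ((norm_nonneg _).trans hy)
      simpa using this
    rw [this]
    simp
  have hpos : 0 < ‖y‖ := norm_pos_iff.2 hy0
  have tail : ∀ z : E, ‖z‖ = ‖y‖ →
      (stdGaussian E).real {g | t * ‖y‖ ≤ ⟪g, z⟫} ≤ rexp (-(t ^ 2 / 2)) := by
    intro z hz
    have hmap := stdGaussian_map_inner (E := E) z
    have hint : Integrable (fun g => rexp (t / ‖y‖ * ⟪g, z⟫)) (stdGaussian E) := by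
      have h := integrable_exp_mul_gaussianReal (μ := 0) (v := (‖z‖ ^ 2).toNNReal) (t / ‖y‖)
      rw [← hmap] at h
      exact h.comp_measurable (by fun_prop)
    refine (measure_ge_le_exp_mul_mgf (t * ‖y‖) (t := t / ‖y‖) (by positivity) hint).trans ?_
    rw [mgf_gaussianReal hmap, ← Real.exp_add, Real.coe_toNNReal _ (by positivity), hz]
    apply le_of_eq
    congr 1
    field_simp
    ring
  have hsub : {g : E | t * R < |⟪g, y⟫|} ⊆
      {g | t * ‖y‖ ≤ ⟪g, y⟫} ∪ {g | t * ‖y‖ ≤ ⟪g, -y⟫} := by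
    intro g hg
    have h1 : t * ‖y‖ < |⟪g, y⟫| := (mul_le_mul_of_nonneg_left hy ht).trans_lt hg
    rcases lt_abs.1 h1 with h | h
    · exact Or.inl h.le
    · refine Or.inr ?_
      simpa [inner_neg_right] using h.le
  rw [ENNReal.le_ofReal_iff_toReal_le (measure_ne_top _ _) (by positivity)]
  calc (stdGaussian E).real _ ≤ (stdGaussian E).real ({g | t * ‖y‖ ≤ ⟪g, y⟫} ∪ _) :=
        measureReal_mono hsub
    _ ≤ _ + _ := measureReal_union_le _ _
    _ ≤ rexp (-(t ^ 2 / 2)) + rexp (-(t ^ 2 / 2)) :=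
        add_le_add (tail y rfl) (tail (-y) (norm_neg y))
    _ = _ := by ring

/-- Integration in polar coordinates of a product of a function of the direction and a function
of the norm. -/
theorem lintegral_direction_mul_norm [Nontrivial E] {A : Set E} (hA : MeasurableSet A)
    {f : ℝ → ℝ≥0∞} (hf : Measurable f) :
    ∫⁻ x : E, A.indicator 1 (‖x‖⁻¹ • x) * f ‖x‖ =
      (volume : Measure E).toSphere (Subtype.val ⁻¹' A) *
        ∫⁻ r, f r.1 ∂(Measure.volumeIoiPow (finrank ℝ E - 1)) := by
  -- Polar coordinates live off the origin, which is a null set.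
  have h0 : (volume : Measure E).restrict {0}ᶜ = volume :=
    Measure.restrict_eq_self_of_ae_mem (by simp [ae_iff])
  have hind : Measurable (A.indicator (1 : E → ℝ≥0∞)) := measurable_one.indicator hA
  rw [← h0, ← lintegral_subtype_comap (measurableSet_singleton _).compl]
  have hmp := Measure.measurePreserving_homeomorphUnitSphereProd (volume : Measure E)
  have h1 : ∀ x : ({0}ᶜ : Set E), A.indicator 1 (‖(x : E)‖⁻¹ • (x : E)) * f ‖(x : E)‖ =
      (fun p : Metric.sphere (0 : E) 1 × Set.Ioi (0 : ℝ) =>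
        (A.indicator 1 (p.1 : E) * f p.2 : ℝ≥0∞)) (homeomorphUnitSphereProd E x) := by
    intro x
    simp
  simp_rw [h1]
  rw [hmp.lintegral_comp (f := fun p : Metric.sphere (0 : E) 1 × Set.Ioi (0 : ℝ) =>
        (A.indicator 1 (p.1 : E) * f p.2 : ℝ≥0∞))
      ((hind.comp (measurable_subtype_coe.comp measurable_fst)).mul
        (hf.comp (measurable_subtype_coe.comp measurable_snd)))]
  rw [h0, lintegral_prod_mul (f := fun p : Metric.sphere (0 : E) 1 => A.indicator 1 (p : E))
    (g := fun r : Set.Ioi (0 : ℝ) => f r)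
    (hind.comp measurable_subtype_coe).aemeasurable (hf.comp measurable_subtype_coe).aemeasurable]
  congr 1
  rw [← lintegral_indicator_one (measurable_subtype_coe hA)]
  rfl

/-- The direction of a standard Gaussian vector is uniformly distributed on the sphere. -/
theorem stdGaussian_direction [Nontrivial E] {A : Set E} (hA : MeasurableSet A) :
    stdGaussian E {x | ‖x‖⁻¹ • x ∈ A} =
      ((volume : Measure E).toSphere Set.univ)⁻¹ *
        (volume : Measure E).toSphere (Subtype.val ⁻¹' A) := by
  set f : ℝ → ℝ≥0∞ := fun r =>
    ENNReal.ofReal ((2 * π) ^ (-(finrank ℝ E / 2 : ℝ)) * rexp (-(1 / 2) * r ^ 2)) with hf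
  have hfm : Measurable f := by fun_prop
  have key : ∀ B : Set E, MeasurableSet B → stdGaussian E {x | ‖x‖⁻¹ • x ∈ B} =
      (volume : Measure E).toSphere (Subtype.val ⁻¹' B) *
        ∫⁻ r, f r.1 ∂(Measure.volumeIoiPow (finrank ℝ E - 1)) := by
    intro B hB
    have hm : MeasurableSet {x : E | ‖x‖⁻¹ • x ∈ B} :=
      (by fun_prop : Measurable fun x : E => ‖x‖⁻¹ • x) hB
    rw [← lintegral_direction_mul_norm hB hfm, stdGaussian_eq_withDensity,
      withDensity_apply _ hm, ← lintegral_indicator hm]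
    refine lintegral_congr fun x => ?_
    by_cases hx : ‖x‖⁻¹ • x ∈ B
    · simp [Set.indicator, hx, hf]
    · simp [Set.indicator, hx]
  -- The case `A = univ` identifies the radial integral as the inverse of the total mass of the
  -- sphere.
  have htot := key Set.univ .univ
  simp only [Set.mem_univ, Set.ofPred_true, measure_univ, Set.preimage_univ] at htot
  rw [key A hA, mul_comm]
  congr 1
  refine (ENNReal.eq_inv_of_mul_eq_one_left ?_)
  rw [mul_comm]
  exact htot.symm

end Gaussian

/-! ### Isotropic Gaussians and the uniform law on the sphere. -/

section Laws

open Real Module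
open scoped RealInnerProductSpace ENNReal MatrixOrder

theorem isoGaussian_eq_map_stdGaussian (k : ℕ) {s : ℝ} (hs : 0 ≤ s) :
    isoGaussian k s = (stdGaussian (Vec k)).map fun g => √s • g := by
  have h : CFC.sqrt (s • (1 : Matrix (Fin k) (Fin k) ℝ)) = √s • 1 := by
    refine CFC.sqrt_unique ?_ ?_
    · rw [smul_mul_smul_comm, mul_one, Real.mul_self_sqrt hs]
    · exact (Matrix.PosSemidef.one.smul (Real.sqrt_nonneg s)).nonneg
  rw [isoGaussian, multivariateGaussian, h]
  congr 1
  ext g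
  simp

instance isProbabilityMeasure_isoGaussian (k : ℕ) (s : ℝ) :
    IsProbabilityMeasure (isoGaussian k s) := by
  unfold isoGaussian
  infer_instance

/-- The vector is `σ/√k` times a standard one. The strict inequality in the event keeps `σ = 0`
admissible. -/
theorem isoGaussian_norm_tail {k : ℕ} (hk : 1 ≤ k) {σ R : ℝ} (hσ : 0 ≤ σ) (hR : 0 ≤ R) :
    isoGaussian k (σ ^ 2 / k) {e | σ * R < ‖e‖} ≤
      ENNReal.ofReal (rexp (k * (log 2 / 2 - R ^ 2 / 4))) := by
  have hk0 : (0 : ℝ) < k := by exact_mod_cast hk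
  rw [isoGaussian_eq_map_stdGaussian k (by positivity), Measure.map_apply (by fun_prop)
    (measurableSet_lt measurable_const measurable_norm)]
  have h := stdGaussian_norm_tail (E := Vec k) hR
  rw [finrank_euclideanSpace_fin] at h
  refine (measure_mono fun g hg => ?_).trans h
  simp only [Set.mem_preimage, Set.mem_ofPred_eq, norm_smul, Real.norm_eq_abs,
    Real.sqrt_div (sq_nonneg σ), Real.sqrt_sq hσ] at hg ⊢
  rw [abs_of_nonneg (by positivity)] at hg
  by_contra hle
  have h1 : σ / √k * ‖g‖ ≤ σ / √k * (R * √k) := by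
    gcongr
    exact not_lt.1 hle
  have h2 : σ / √k * (R * √k) = σ * R := by
    have : √(k : ℝ) ≠ 0 := by positivity
    field_simp
  linarith

/-- Tail of the inner product of a Gaussian vector with an independent vector. -/
theorem isoGaussian_prod_inner_tail {k : ℕ} {s t R : ℝ} (hs : 0 ≤ s) (ht : 0 ≤ t)
    (ν : Measure (Vec k)) [IsProbabilityMeasure ν] :
    ((isoGaussian k s).prod ν) {p | t * √s * R < |⟪p.1, p.2⟫|} ≤
      ν {y | R < ‖y‖} + ENNReal.ofReal (2 * rexp (-(t ^ 2 / 2))) := by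
  have hm : MeasurableSet {p : Vec k × Vec k | t * √s * R < |⟪p.1, p.2⟫|} :=
    measurableSet_lt measurable_const (by fun_prop)
  have hmR : MeasurableSet {y : Vec k | R < ‖y‖} :=
    measurableSet_lt measurable_const measurable_norm
  rw [Measure.prod_apply_symm hm]
  -- For fixed `y`, the inner probability is bounded by 1 if `R < ‖y‖` and by the linear Gaussian
  -- tail otherwise.
  calc ∫⁻ y, isoGaussian k s ((fun x => (x, y)) ⁻¹' {p | t * √s * R < |⟪p.1, p.2⟫|}) ∂ν
      ≤ ∫⁻ y, ({y : Vec k | R < ‖y‖}.indicator 1 y +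
          ENNReal.ofReal (2 * rexp (-(t ^ 2 / 2)))) ∂ν := by
        refine lintegral_mono fun y => ?_
        by_cases hy : R < ‖y‖
        · refine prob_le_one.trans ?_
          simp [Set.indicator, hy]
        · refine le_add_left ?_
          rw [isoGaussian_eq_map_stdGaussian k hs, Measure.map_apply (by fun_prop)
            ((by fun_prop : Measurable fun x : Vec k => (x, y)) hm)]
          refine (measure_mono fun g hg => ?_).trans
            (stdGaussian_inner_tail y ht (not_lt.1 hy))
          simp only [Set.mem_preimage, Set.mem_ofPred_eq, real_inner_smul_left, abs_mul,
            abs_of_nonneg (Real.sqrt_nonneg s)] at hg ⊢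
          by_contra hle
          have : √s * |⟪g, y⟫| ≤ √s * (t * R) := by
            gcongr
            exact not_lt.1 hle
          linarith
    _ = _ := by
        rw [lintegral_add_right _ measurable_const, lintegral_indicator_one hmR]
        simp

theorem nontrivial_vec {k : ℕ} (hk : 1 ≤ k) : Nontrivial (Vec k) :=
  Module.nontrivial_of_finrank_pos (R := ℝ) (by rw [finrank_euclideanSpace_fin]; omega)

theorem uniformSphere_apply {k : ℕ} {A : Set (Vec k)} (hA : MeasurableSet A) :
    uniformSphere k A = ((volume : Measure (Vec k)).toSphere Set.univ)⁻¹ *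
      (volume : Measure (Vec k)).toSphere (Subtype.val ⁻¹' A) := by
  rw [uniformSphere, Measure.map_apply measurable_subtype_coe hA, Measure.smul_apply, smul_eq_mul]

theorem isProbabilityMeasure_uniformSphere {k : ℕ} (hk : 1 ≤ k) :
    IsProbabilityMeasure (uniformSphere k) := by
  have := nontrivial_vec hk
  refine ⟨?_⟩
  rw [uniformSphere_apply .univ, Set.preimage_univ]
  refine ENNReal.inv_mul_cancel ?_ (measure_ne_top _ _)
  rw [Ne, Measure.measure_univ_eq_zero]
  exact Measure.toSphere_ne_zero _

theorem ae_norm_uniformSphere (k : ℕ) : ∀ᵐ a ∂uniformSphere k, ‖a‖ = 1 := by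
  have hm : MeasurableSet {a : Vec k | ¬ ‖a‖ = 1} :=
    (measurableSet_eq_fun measurable_norm measurable_const).compl
  rw [ae_iff, uniformSphere_apply hm]
  have : (Subtype.val ⁻¹' {a : Vec k | ¬ ‖a‖ = 1} : Set (Metric.sphere (0 : Vec k) 1)) = ∅ := by
    ext a
    simp
  rw [this]
  simp

theorem uniformSphere_eq_stdGaussian {k : ℕ} (hk : 1 ≤ k) {A : Set (Vec k)}
    (hA : MeasurableSet A) :
    uniformSphere k A = stdGaussian (Vec k) {x | ‖x‖⁻¹ • x ∈ A} := by
  have := nontrivial_vec hk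
  rw [uniformSphere_apply hA, stdGaussian_direction hA]

/-- The density is at most `1/√(2π)` on an interval of length `2r`. -/
theorem gaussianReal_abs_lt_le (r : ℝ) :
    gaussianReal 0 1 {x | |x| < r} ≤ ENNReal.ofReal (r * √(2 / π)) := by
  rw [gaussianReal_apply _ one_ne_zero]
  have hset : {x : ℝ | |x| < r} = Set.Ioo (-r) r := by
    ext x
    simp [abs_lt]
  calc ∫⁻ x in {x : ℝ | |x| < r}, gaussianPDF 0 1 x
      ≤ ∫⁻ x in {x : ℝ | |x| < r}, ENNReal.ofReal (√(2 * π))⁻¹ := by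
        refine lintegral_mono fun x => ENNReal.ofReal_le_ofReal ?_
        rw [gaussianPDFReal_def]
        simp only [NNReal.coe_one, mul_one, sub_zero]
        refine mul_le_of_le_one_right (by positivity) (Real.exp_le_one_iff.2 ?_)
        have := sq_nonneg x
        linarith
    _ = ENNReal.ofReal (r * √(2 / π)) := by
        rw [lintegral_const, Measure.restrict_apply_univ, hset, Real.volume_Ioo,
          ← ENNReal.ofReal_mul (by positivity)]
        congr 1
        rw [Real.sqrt_mul (by norm_num), Real.sqrt_div (by norm_num)]
        have h2 : √(2 : ℝ) ≠ 0 := by positivity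
        have hpi : √π ≠ 0 := by positivity
        field_simp
        rw [Real.sq_sqrt (by norm_num)]
        ring

/-- A small-ball estimate for the uniform law on the sphere: a coordinate is rarely much smaller
than `1 / √k`. -/
theorem uniformSphere_small_ball {k : ℕ} (hk : 1 ≤ k) {u : Vec k} (hu : ‖u‖ = 1) :
    uniformSphere k {a | |⟪a, u⟫| < 1 / 10 / √k} ≤ ENNReal.ofReal √(2 / π) := by
  have hk0 : (1 : ℝ) ≤ k := by exact_mod_cast hk
  have hsk : 0 < √(k : ℝ) := by positivity
  rw [uniformSphere_eq_stdGaussian hk (measurableSet_lt (by fun_prop) measurable_const)]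
  -- If `‖x‖ ≤ 4√k`, a small direction coordinate forces `|⟪x, u⟫| < 4/10`. The first two events
  -- will each cost at most `2/5 * √(2/π)`. The origin is listed apart because `‖0‖⁻¹ = 0` puts it
  -- in the left set.
  have hsub : {x : Vec k | ‖x‖⁻¹ • x ∈ {a : Vec k | |⟪a, u⟫| < 1 / 10 / √k}} ⊆
      (fun x => ⟪x, u⟫) ⁻¹' {x : ℝ | |x| < 2 / 5} ∪ {x : Vec k | 4 * √k < ‖x‖} ∪ {0} := by
    intro x hx
    by_cases hx0 : x = 0
    · exact Or.inr hx0
    refine Or.inl ?_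
    by_cases hx4 : 4 * √k < ‖x‖
    · exact Or.inr hx4
    refine Or.inl ?_
    have hxp : 0 < ‖x‖ := norm_pos_iff.2 hx0
    simp only [Set.mem_ofPred_eq, real_inner_smul_left, abs_mul, abs_inv, abs_norm,
      Set.mem_preimage] at hx ⊢
    rw [inv_mul_lt_iff₀ hxp] at hx
    refine hx.trans_le ?_
    rw [not_lt] at hx4
    calc ‖x‖ * (1 / 10 / √k) ≤ 4 * √k * (1 / 10 / √k) := by gcongr
      _ = 2 / 5 := by field_simp; norm_num
  have hzero : stdGaussian (Vec k) {0} = 0 := by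
    have := nontrivial_vec hk
    rw [stdGaussian_eq_withDensity]
    exact withDensity_absolutelyContinuous _ _ (measure_singleton _)
  have h1 : stdGaussian (Vec k) ((fun x => ⟪x, u⟫) ⁻¹' {x : ℝ | |x| < 2 / 5}) ≤
      ENNReal.ofReal (2 / 5 * √(2 / π)) := by
    rw [← Measure.map_apply (by fun_prop) (measurableSet_lt (by fun_prop) measurable_const),
      stdGaussian_map_inner, hu]
    simpa using gaussianReal_abs_lt_le (2 / 5)
  have h2 : stdGaussian (Vec k) {x : Vec k | 4 * √k < ‖x‖} ≤ ENNReal.ofReal (2 / 5 * √(2 / π)) := by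
    have h := stdGaussian_norm_tail (E := Vec k) (R := 4) (by norm_num)
    rw [finrank_euclideanSpace_fin] at h
    refine h.trans (ENNReal.ofReal_le_ofReal ?_)
    have hlog : log 2 < 1 := log_two_lt_d9.trans (by norm_num)
    have hsq : (1 / 2 : ℝ) ≤ √(2 / π) := by
      refine Real.le_sqrt_of_sq_le ?_
      rw [le_div_iff₀ pi_pos]
      linarith [pi_le_four]
    calc rexp (k * (log 2 / 2 - 4 ^ 2 / 4)) ≤ rexp (-(1 + 1)) := by
          refine Real.exp_le_exp.2 ?_
          nlinarith
      _ ≤ 1 / 5 := by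
          rw [Real.exp_neg, Real.exp_add, inv_eq_one_div]
          have := Real.exp_one_gt_d9
          gcongr
          nlinarith
      _ ≤ 2 / 5 * √(2 / π) := by linarith
  calc stdGaussian (Vec k) {x : Vec k | ‖x‖⁻¹ • x ∈ {a : Vec k | |⟪a, u⟫| < 1 / 10 / √k}}
      ≤ stdGaussian (Vec k) ((fun x => ⟪x, u⟫) ⁻¹' {x : ℝ | |x| < 2 / 5}) +
        stdGaussian (Vec k) {x : Vec k | 4 * √k < ‖x‖} + stdGaussian (Vec k) {0} :=
        (measure_mono hsub).trans ((measure_union_le _ _).trans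
          (add_le_add_left (measure_union_le _ _) _))
    _ ≤ ENNReal.ofReal (2 / 5 * √(2 / π)) + ENNReal.ofReal (2 / 5 * √(2 / π)) + 0 :=
        add_le_add (add_le_add h1 h2) hzero.le
    _ ≤ _ := by
        rw [add_zero, ← ENNReal.ofReal_add (by positivity) (by positivity)]
        refine ENNReal.ofReal_le_ofReal ?_
        have : 0 ≤ √(2 / π) := by positivity
        linarith

/-- All but one of finitely many independent uniform unit vectors are nearly orthogonal to the
remaining one with at most geometrically small probability. -/
theorem pi_uniformSphere_all_nearly_orthogonal {k n : ℕ} (hk : 1 ≤ k) (j : Fin n) :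
    (Measure.pi fun _ : Fin n => uniformSphere k)
      {a | ∀ p, p ≠ j → |⟪a p, a j⟫| < 1 / 10 / √k} ≤
      ENNReal.ofReal (rexp (-(1 / 2) * log (π / 2) * ((n : ℝ) - 1))) := by
  have := isProbabilityMeasure_uniformSphere hk
  -- Splitting off coordinate `j` leaves `n'` coordinates independent of it; hence the exponent `n -
  -- 1`.
  obtain ⟨n, rfl⟩ : ∃ n', n = n' + 1 := ⟨n - 1, by have := j.2; omega⟩
  have hmp := measurePreserving_piFinSuccAbove (fun _ : Fin (n + 1) => uniformSphere k) j
  set S : Set (Vec k × (Fin n → Vec k)) := {q | ∀ i, |⟪q.2 i, q.1⟫| < 1 / 10 / √k} with hS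
  have hSm : MeasurableSet S := by
    rw [hS, Set.ofPred_forall]
    exact MeasurableSet.iInter fun i => measurableSet_lt (by fun_prop) measurable_const
  have hpre : {a : Fin (n + 1) → Vec k | ∀ p, p ≠ j → |⟪a p, a j⟫| < 1 / 10 / √k} =
      MeasurableEquiv.piFinSuccAbove (fun _ : Fin (n + 1) => Vec k) j ⁻¹' S := by
    ext a
    constructor
    · intro h i
      exact h _ (Fin.succAbove_ne j i)
    · intro h p hp
      obtain ⟨i, rfl⟩ := Fin.exists_succAbove_eq hp
      exact h i
  rw [hpre, hmp.measure_preimage hSm.nullMeasurableSet, Measure.prod_apply hSm]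
  calc ∫⁻ u, (Measure.pi fun _ : Fin n => uniformSphere k) (Prod.mk u ⁻¹' S) ∂uniformSphere k
      ≤ ∫⁻ _, ENNReal.ofReal √(2 / π) ^ n ∂uniformSphere k := by
        refine lintegral_mono_ae ?_
        filter_upwards [ae_norm_uniformSphere k] with u hu
        have hset : Prod.mk u ⁻¹' S =
            Set.univ.pi fun _ : Fin n => {a : Vec k | |⟪a, u⟫| < 1 / 10 / √k} := by
          ext a
          simp [hS]
        rw [hset, Measure.pi_pi, Finset.prod_const, Finset.card_univ, Fintype.card_fin]
        gcongr
        exact uniformSphere_small_ball hk hu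
    _ = ENNReal.ofReal (rexp (-(1 / 2) * log (π / 2) * (((n + 1 : ℕ) : ℝ) - 1))) := by
        rw [lintegral_const, measure_univ, mul_one, ← ENNReal.ofReal_pow (by positivity)]
        congr 1
        have h : √(2 / π) = rexp (-(1 / 2) * log (π / 2)) := by
          rw [Real.sqrt_eq_rpow, Real.rpow_def_of_pos (by positivity), ← inv_div π 2,
            Real.log_inv]
          congr 1
          ring
        rw [h, ← Real.exp_nat_mul]
        congr 1
        push_cast
        ring

end Laws

/-! ### Probability and linear-algebra tools; calibration to powers of `N`. -/

section Tools

open Real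
open scoped RealInnerProductSpace ENNReal

theorem measurePreserving_eval_pair {ι : Type*} [Fintype ι] {α : ι → Type*}
    [∀ i, MeasurableSpace (α i)] (μ : ∀ i, Measure (α i)) [∀ i, IsProbabilityMeasure (μ i)]
    {i j : ι} (hij : i ≠ j) :
    MeasurePreserving (fun f : ∀ i, α i => (f i, f j)) (Measure.pi μ) ((μ i).prod (μ j)) where
  measurable := by fun_prop
  map_eq := by
    have h := (iIndepFun_pi (μ := μ) (X := fun _ x => x) fun _ => aemeasurable_id).indepFun hij
    rw [(indepFun_iff_map_prod_eq_prod_map_map (measurable_pi_apply i).aemeasurable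
      (measurable_pi_apply j).aemeasurable).1 h]
    exact congrArg₂ Measure.prod (measurePreserving_eval μ i).map_eq
      (measurePreserving_eval μ j).map_eq

/-- Subadditivity on `S ∪ Sᶜ` suffices, so `S` need not be measurable. -/
theorem one_sub_le_measureReal_of_compl_subset {Ω : Type*} {mΩ : MeasurableSpace Ω}
    {P : Measure Ω} [IsProbabilityMeasure P] {S T : Set Ω} {b : ℝ} (hb : 0 ≤ b) (hST : Sᶜ ⊆ T)
    (hT : P T ≤ ENNReal.ofReal b) : 1 - b ≤ P.real S := by
  have h1 : P.real (S ∪ Sᶜ) ≤ P.real S + P.real Sᶜ := measureReal_union_le _ _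
  rw [Set.union_compl_self, probReal_univ] at h1
  have h2 : P.real Sᶜ ≤ b := ENNReal.toReal_le_of_le_ofReal hb ((measure_mono hST).trans hT)
  linarith

/-- Tail of the inner product of a Gaussian vector with a function of an independent variable. -/
theorem measure_inner_tail {Ω T : Type*} {mΩ : MeasurableSpace Ω} {mT : MeasurableSpace T}
    {P : Measure Ω} {k : ℕ} {s t R : ℝ} (hs : 0 ≤ s) (ht : 0 ≤ t)
    {ν : Measure T} [IsProbabilityMeasure ν] {X : Ω → Vec k} {Y : Ω → T}
    (hXY : HasLaw (fun ω => (X ω, Y ω)) ((isoGaussian k s).prod ν) P)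
    {f : T → Vec k} (hf : Measurable f) :
    P {ω | t * √s * R < |⟪X ω, f (Y ω)⟫|} ≤
      ν {y | R < ‖f y‖} + ENNReal.ofReal (2 * rexp (-(t ^ 2 / 2))) := by
  have : IsProbabilityMeasure (ν.map f) := Measure.isProbabilityMeasure_map hf.aemeasurable
  have hfm : MeasurePreserving f ν (ν.map f) := hf.measurePreserving ν
  have hlaw := (((MeasurePreserving.id (isoGaussian k s)).prod hfm)).fun_comp_hasLaw hXY
  have hm : MeasurableSet {p : Vec k × Vec k | t * √s * R < |⟪p.1, p.2⟫|} :=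
    measurableSet_lt measurable_const (by fun_prop)
  have h := isoGaussian_prod_inner_tail (R := R) hs ht (ν.map f)
  rw [Measure.map_apply hf (measurableSet_lt measurable_const measurable_norm),
    ← hlaw.measure_eq hm] at h
  exact h

theorem exp_neg_three_mul_log {N : ℕ} (hN : 0 < N) :
    rexp (-(3 * log N)) = 1 / (N : ℝ) ^ 3 := by
  have : (0 : ℝ) < N := by exact_mod_cast hN
  rw [Real.exp_neg, mul_comm, Real.exp_mul, Real.exp_log this, one_div]
  norm_cast

/-- For `R ≥ 39/20` the rate `log 2 / 2 - R²/4` is at most `-1/2`, so the exponent is at most `-m/2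
≤ -3 log N`. -/
theorem isoGaussian_norm_tail_of_log_le {m N : ℕ} (hm : 1 ≤ m) (hN : 0 < N)
    (hmN : 6 * log N ≤ m) {σ R : ℝ} (hσ : 0 ≤ σ) (hR : 39 / 20 ≤ R) :
    isoGaussian m (σ ^ 2 / m) {e | σ * R < ‖e‖} ≤ ENNReal.ofReal (1 / (N : ℝ) ^ 3) := by
  refine (isoGaussian_norm_tail hm hσ (by linarith)).trans (ENNReal.ofReal_le_ofReal ?_)
  rw [← exp_neg_three_mul_log hN]
  refine Real.exp_le_exp.2 ?_
  have hm0 : (0 : ℝ) ≤ m := Nat.cast_nonneg m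
  have h1 : log 2 / 2 - R ^ 2 / 4 ≤ -(1 / 2) := by
    have := log_two_lt_d9
    nlinarith
  have h2 := mul_le_mul_of_nonneg_left h1 hm0
  linarith

theorem two_mul_exp_sqrt {N : ℕ} (hN : 0 < N) :
    2 * rexp (-(√(6 * log N) ^ 2 / 2)) = 2 / (N : ℝ) ^ 3 := by
  rw [Real.sq_sqrt (mul_nonneg (by norm_num) (log_natCast_nonneg N)),
    show 6 * log N / 2 = 3 * log N by ring, exp_neg_three_mul_log hN]
  ring

theorem inner_toLp_mulVec {m d : ℕ} {U : Matrix (Fin m) (Fin d) ℝ} (hU : U.transpose * U = 1)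
    (a b : Vec d) :
    ⟪(WithLp.toLp 2 (U.mulVec a.ofLp) : Vec m), WithLp.toLp 2 (U.mulVec b.ofLp)⟫ = ⟪a, b⟫ := by
  rw [EuclideanSpace.inner_eq_star_dotProduct, EuclideanSpace.inner_eq_star_dotProduct]
  simp only [star_trivial]
  rw [Matrix.dotProduct_mulVec, Matrix.vecMul_mulVec, ← Matrix.dotProduct_mulVec, hU,
    Matrix.one_mulVec]

theorem norm_toLp_mulVec {m d : ℕ} {U : Matrix (Fin m) (Fin d) ℝ} (hU : U.transpose * U = 1)
    (a : Vec d) : ‖(WithLp.toLp 2 (U.mulVec a.ofLp) : Vec m)‖ = ‖a‖ := by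
  rw [← sq_eq_sq₀ (norm_nonneg _) (norm_nonneg _), ← real_inner_self_eq_norm_sq,
    inner_toLp_mulVec hU, real_inner_self_eq_norm_sq]

theorem measurable_toLp_mulVec {m d : ℕ} (U : Matrix (Fin m) (Fin d) ℝ) :
    Measurable fun a : Vec d => (WithLp.toLp 2 (U.mulVec a.ofLp) : Vec m) := by
  have : Continuous fun a : Vec d => (WithLp.toLp 2 (U.mulVec a.ofLp) : Vec m) := by fun_prop
  exact this.measurable

theorem card_dataIndex {L : ℕ} (N₀ : ℕ) (n : Fin L → ℕ) :
    Fintype.card (DataIndex N₀ n) = numPoints N₀ n := by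
  simp [DataIndex, numPoints]

end Tools

/-! ### The data model: marginal laws, pairwise bounds, union bounds. -/

section Model

open Real
open scoped RealInnerProductSpace ENNReal

variable {m L N₀ : ℕ} {d n : Fin L → ℕ} {σ : ℝ} {Ω : Type*} {mΩ : MeasurableSpace Ω}
  {P : Measure Ω} {o : Ω → Fin N₀ → Vec m} {a : Ω → (l : Fin L) → Fin (n l) → Vec (d l)}
  {e : Ω → (l : Fin L) → Fin (n l) → Vec m}

/-- This lemma and its analogues below put a Gaussian vector first and an independent variable
second, as `measure_inner_tail` requires. -/
theorem hasLaw_outlier_pair (hd : ∀ l, 1 ≤ d l)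
    (h : HasLaw (fun ω => (o ω, a ω, e ω)) (ingredientsLaw m N₀ d n σ) P)
    {i i' : Fin N₀} (hi : i ≠ i') :
    HasLaw (fun ω => (o ω i, o ω i')) ((isoGaussian m (1 / m)).prod (isoGaussian m (1 / m))) P := by
  have := fun l => isProbabilityMeasure_uniformSphere (hd l)
  unfold ingredientsLaw at h
  exact (measurePreserving_eval_pair (fun _ : Fin N₀ => isoGaussian m (1 / m)) hi).fun_comp_hasLaw
    (measurePreserving_fst.fun_comp_hasLaw h)

theorem hasLaw_outlier_inlier (hd : ∀ l, 1 ≤ d l)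
    (h : HasLaw (fun ω => (o ω, a ω, e ω)) (ingredientsLaw m N₀ d n σ) P)
    (i : Fin N₀) (l : Fin L) (j : Fin (n l)) :
    HasLaw (fun ω => (o ω i, (a ω l j, e ω l j)))
      ((isoGaussian m (1 / m)).prod ((uniformSphere (d l)).prod (isoGaussian m (σ ^ 2 / m)))) P := by
  have := fun l => isProbabilityMeasure_uniformSphere (hd l)
  unfold ingredientsLaw at h
  have ho := measurePreserving_eval (fun _ : Fin N₀ => isoGaussian m (1 / m)) i
  have ha := (measurePreserving_eval (fun _ : Fin (n l) => uniformSphere (d l)) j).comp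
    (measurePreserving_eval
      (fun l : Fin L => Measure.pi fun _ : Fin (n l) => uniformSphere (d l)) l)
  have he := (measurePreserving_eval (fun _ : Fin (n l) => isoGaussian m (σ ^ 2 / m)) j).comp
    (measurePreserving_eval
      (fun l : Fin L => Measure.pi fun _ : Fin (n l) => isoGaussian m (σ ^ 2 / m)) l)
  exact (ho.prod (ha.prod he)).fun_comp_hasLaw h

theorem hasLaw_coefficients (hd : ∀ l, 1 ≤ d l)
    (h : HasLaw (fun ω => (o ω, a ω, e ω)) (ingredientsLaw m N₀ d n σ) P) (l : Fin L) :
    HasLaw (fun ω => a ω l) (Measure.pi fun _ : Fin (n l) => uniformSphere (d l)) P := by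
  have := fun l => isProbabilityMeasure_uniformSphere (hd l)
  unfold ingredientsLaw at h
  exact (measurePreserving_eval (fun l : Fin L => Measure.pi fun _ : Fin (n l) =>
    uniformSphere (d l)) l).fun_comp_hasLaw
    (measurePreserving_fst.fun_comp_hasLaw (measurePreserving_snd.fun_comp_hasLaw h))

theorem hasLaw_noise_coefficient (hd : ∀ l, 1 ≤ d l)
    (h : HasLaw (fun ω => (o ω, a ω, e ω)) (ingredientsLaw m N₀ d n σ) P)
    (l : Fin L) (p j : Fin (n l)) :
    HasLaw (fun ω => (e ω l p, a ω l j))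
      ((isoGaussian m (σ ^ 2 / m)).prod (uniformSphere (d l))) P := by
  have := fun l => isProbabilityMeasure_uniformSphere (hd l)
  unfold ingredientsLaw at h
  have ha := (measurePreserving_eval (fun _ : Fin (n l) => uniformSphere (d l)) j).comp
    (measurePreserving_eval
      (fun l : Fin L => Measure.pi fun _ : Fin (n l) => uniformSphere (d l)) l)
  have he := (measurePreserving_eval (fun _ : Fin (n l) => isoGaussian m (σ ^ 2 / m)) p).comp
    (measurePreserving_eval
      (fun l : Fin L => Measure.pi fun _ : Fin (n l) => isoGaussian m (σ ^ 2 / m)) l)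
  exact (Measure.measurePreserving_swap.comp (ha.prod he)).fun_comp_hasLaw
    (measurePreserving_snd.fun_comp_hasLaw h)

theorem hasLaw_noise_pair (hd : ∀ l, 1 ≤ d l)
    (h : HasLaw (fun ω => (o ω, a ω, e ω)) (ingredientsLaw m N₀ d n σ) P)
    (l : Fin L) {p j : Fin (n l)} (hpj : p ≠ j) :
    HasLaw (fun ω => (e ω l p, e ω l j))
      ((isoGaussian m (σ ^ 2 / m)).prod (isoGaussian m (σ ^ 2 / m))) P := by
  have := fun l => isProbabilityMeasure_uniformSphere (hd l)
  unfold ingredientsLaw at h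
  exact (measurePreserving_eval_pair (fun _ : Fin (n l) => isoGaussian m (σ ^ 2 / m))
      hpj).fun_comp_hasLaw
    ((measurePreserving_eval (fun l : Fin L => Measure.pi fun _ : Fin (n l) =>
      isoGaussian m (σ ^ 2 / m)) l).fun_comp_hasLaw
      (measurePreserving_snd.fun_comp_hasLaw (measurePreserving_snd.fun_comp_hasLaw h)))

/-- By Cauchy–Schwarz, `1 + bσ ≤ √(1 + b²) √(1 + σ²)`; with `b = 39/20` the first root is below
`11/5`, uniformly in `σ`. -/
theorem norm_normalized_sum_le {v w : Vec m} (hv : ‖v‖ = 1)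
    (hw : ‖w‖ ≤ σ * (39 / 20)) : ‖(1 / √(1 + σ ^ 2)) • (v + w)‖ ≤ 11 / 5 := by
  have hpos : 0 < √(1 + σ ^ 2) := by positivity
  rw [norm_smul, Real.norm_eq_abs, abs_of_pos (by positivity), one_div, inv_mul_le_iff₀ hpos]
  have h1 : ‖v + w‖ ≤ 1 + σ * (39 / 20) := (norm_add_le v w).trans (by linarith)
  refine h1.trans ?_
  have h2 : 1 + σ * (39 / 20) ≤ √((1 + σ ^ 2) * (11 / 5) ^ 2) := by
    refine Real.le_sqrt_of_sq_le ?_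
    nlinarith [sq_nonneg (σ - 39 / 20)]
  rwa [Real.sqrt_mul (by positivity), Real.sqrt_sq (by norm_num)] at h2

/-- The inner product of an outlier with another data point is small with high probability. -/
theorem outlier_inner_tail (hd : ∀ l, 1 ≤ d l) {U : (l : Fin L) → Matrix (Fin m) (Fin (d l)) ℝ}
    (hU : ∀ l, (U l).transpose * U l = 1) (hσ : 0 ≤ σ) [IsProbabilityMeasure P]
    (h : HasLaw (fun ω => (o ω, a ω, e ω)) (ingredientsLaw m N₀ d n σ) P)
    {N : ℕ} (hN : 0 < N) (hm : 1 ≤ m) (hmN : 6 * log N ≤ m) (i : Fin N₀) (p : DataIndex N₀ n)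
    (hp : p ≠ Sum.inl i) :
    P {ω | √(6 * log N) * √(1 / m) * (11 / 5) <
      |⟪o ω i, dataPoint U σ (o ω) (a ω) (e ω) p⟫|} ≤ ENNReal.ofReal (3 / (N : ℝ) ^ 3) := by
  have h3 : ENNReal.ofReal (3 / (N : ℝ) ^ 3) = ENNReal.ofReal (1 / (N : ℝ) ^ 3) +
      ENNReal.ofReal (2 * rexp (-(√(6 * log N) ^ 2 / 2))) := by
    rw [two_mul_exp_sqrt hN, ← ENNReal.ofReal_add (by positivity) (by positivity)]
    congr 1
    ring
  rw [h3]
  rcases p with i' | ⟨l, j⟩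
  · have hne : i ≠ i' := fun hii => hp (by rw [hii])
    refine (measure_inner_tail (by positivity) (Real.sqrt_nonneg _)
      (hasLaw_outlier_pair hd h hne) measurable_id).trans (add_le_add_left ?_ _)
    have := isoGaussian_norm_tail_of_log_le hm hN hmN zero_le_one
      (show (39 / 20 : ℝ) ≤ 11 / 5 by norm_num)
    simpa using this
  · have := isProbabilityMeasure_uniformSphere (hd l)
    have hsum : Measurable fun y : Vec (d l) × Vec m =>
        (WithLp.toLp 2 ((U l).mulVec y.1.ofLp) : Vec m) + y.2 :=
      ((measurable_toLp_mulVec (U l)).comp measurable_fst).add measurable_snd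
    have hf : Measurable fun y : Vec (d l) × Vec m =>
        (1 / √(1 + σ ^ 2)) • ((WithLp.toLp 2 ((U l).mulVec y.1.ofLp) : Vec m) + y.2) :=
      hsum.const_smul (1 / √(1 + σ ^ 2))
    refine (measure_inner_tail (by positivity) (Real.sqrt_nonneg _)
      (hasLaw_outlier_inlier hd h i l j) hf).trans (add_le_add_left ?_ _)
    calc ((uniformSphere (d l)).prod (isoGaussian m (σ ^ 2 / m)))
          {y | 11 / 5 < ‖(1 / √(1 + σ ^ 2)) •
            ((WithLp.toLp 2 ((U l).mulVec y.1.ofLp) : Vec m) + y.2)‖}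
        ≤ ((uniformSphere (d l)).prod (isoGaussian m (σ ^ 2 / m)))
          (Prod.snd ⁻¹' {e | σ * (39 / 20) < ‖e‖}) := by
          refine measure_mono_ae ?_
          have h1 := (measurePreserving_fst (μ := uniformSphere (d l))
            (ν := isoGaussian m (σ ^ 2 / m))).quasiMeasurePreserving.ae (ae_norm_uniformSphere (d l))
          filter_upwards [h1] with y hy1 hy
          by_contra hle
          refine absurd (norm_normalized_sum_le ?_ (not_lt.1 hle)) (not_le.2 hy)
          rw [norm_toLp_mulVec (hU l), hy1]
      _ = isoGaussian m (σ ^ 2 / m) {e | σ * (39 / 20) < ‖e‖} :=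
          measurePreserving_snd.measure_preimage
            (measurableSet_lt measurable_const measurable_norm).nullMeasurableSet
      _ ≤ _ := isoGaussian_norm_tail_of_log_le hm hN hmN hσ le_rfl

/-- With high probability all outliers are detected. -/
theorem outliers_detected (hd : ∀ l, 1 ≤ d l) {U : (l : Fin L) → Matrix (Fin m) (Fin (d l)) ℝ}
    (hU : ∀ l, (U l).transpose * U l = 1) (hσ : 0 ≤ σ) [IsProbabilityMeasure P]
    (h : HasLaw (fun ω => (o ω, a ω, e ω)) (ingredientsLaw m N₀ d n σ) P)
    (hmN : 6 * log (numPoints N₀ n) ≤ m) :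
    1 - 3 * ((N₀ : ℝ) / (numPoints N₀ n : ℝ) ^ 2) ≤
      P.real {ω | ∀ i : Fin N₀,
        DeclaredOutlier (2.3 * √6) (dataPoint U σ (o ω) (a ω) (e ω)) (Sum.inl i)} := by
  set N := numPoints N₀ n with hNdef
  have hN₀N : N₀ ≤ N := Nat.le_add_right _ _
  rcases Nat.eq_zero_or_pos N₀ with h0 | h0
  · subst h0
    simp
  -- For `N = 1` the claimed lower bound is negative. Excluding it gives `log N > 0`, hence `m > 0`.
  by_cases hN1 : N = 1
  · refine le_trans ?_ measureReal_nonneg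
    have h1 : (1 : ℝ) ≤ N₀ := by exact_mod_cast h0
    rw [hN1, Nat.cast_one]
    linarith
  have hN2 : (2 : ℝ) ≤ N := by exact_mod_cast (by omega : 2 ≤ N)
  have hN : 0 < N := by omega
  have hlog : 0 < log N := Real.log_pos (by linarith)
  have hm0 : (0 : ℝ) < m := by linarith
  have hm : 1 ≤ m := by exact_mod_cast hm0
  -- The slack between `11/5` and `2.3` gives the strict inequality in `DeclaredOutlier`.
  have hrad : √(6 * log N) * √(1 / m) * (11 / 5) < 2.3 * √6 * √(log N) / √m := by
    rw [Real.sqrt_mul (by norm_num), Real.sqrt_div (by norm_num), Real.sqrt_one]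
    have hq : 0 < √6 * √(log N) / √m := by positivity
    calc √6 * √(log N) * (1 / √m) * (11 / 5) = √6 * √(log N) / √m * (11 / 5) := by ring
      _ < √6 * √(log N) / √m * 2.3 := by
          gcongr
          norm_num
      _ = _ := by ring
  refine one_sub_le_measureReal_of_compl_subset (by positivity)
    (T := ⋃ i : Fin N₀, ⋃ p : DataIndex N₀ n, {ω | p ≠ Sum.inl i ∧
      √(6 * log N) * √(1 / m) * (11 / 5) < |⟪o ω i, dataPoint U σ (o ω) (a ω) (e ω) p⟫|}) ?_ ?_
  · intro ω hω
    by_contra hcon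
    refine hω fun i p hp => ?_
    simp only [Set.mem_iUnion, Set.mem_ofPred_eq, not_exists, not_and, not_lt] at hcon
    rw [card_dataIndex, real_inner_comm]
    exact (hcon i p hp).trans_lt hrad
  · refine (measure_iUnion_fintype_le _ _).trans ?_
    calc ∑ i : Fin N₀, P (⋃ p : DataIndex N₀ n, {ω | p ≠ Sum.inl i ∧
          √(6 * log N) * √(1 / m) * (11 / 5) < |⟪o ω i, dataPoint U σ (o ω) (a ω) (e ω) p⟫|})
        ≤ ∑ _i : Fin N₀, ∑ _p : DataIndex N₀ n, ENNReal.ofReal (3 / (N : ℝ) ^ 3) := by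
          refine Finset.sum_le_sum fun i _ => (measure_iUnion_fintype_le _ _).trans
            (Finset.sum_le_sum fun p _ => ?_)
          by_cases hp : p = Sum.inl i
          · simp [hp]
          · exact (measure_mono fun ω hω => hω.2).trans
              (outlier_inner_tail hd hU hσ h hN hm hmN i p hp)
      _ = ENNReal.ofReal (3 * ((N₀ : ℝ) / (N : ℝ) ^ 2)) := by
          simp only [Finset.sum_const, Finset.card_univ, card_dataIndex, Fintype.card_fin, ← hNdef,
            nsmul_eq_mul]
          rw [← ENNReal.ofReal_natCast, ← ENNReal.ofReal_natCast,
            ← ENNReal.ofReal_mul (by positivity), ← ENNReal.ofReal_mul (by positivity)]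
          congr 1
          field_simp

/-- If the coefficients of two inliers of one subspace are correlated and the noise is tame, then
the inliers themselves are correlated. -/
theorem le_abs_inner_inliers {v w f g : Vec m} {k : ℕ} {r : ℝ} (hr : 0 ≤ r)
    (hrk : r * (1 + σ ^ 2) ≤ 1 / 60 / √k)
    (hvw : 1 / 10 / √k ≤ |⟪v, w⟫|) (hfw : |⟪f, w⟫| ≤ r * σ) (hgv : |⟪g, v⟫| ≤ r * σ)
    (hfg : |⟪f, g⟫| ≤ r * σ * (σ * 2)) :
    2.3 * r ≤ |⟪(1 / √(1 + σ ^ 2)) • (v + f), (1 / √(1 + σ ^ 2)) • (w + g)⟫| := by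
  have hpos : 0 < 1 + σ ^ 2 := by positivity
  have hs : √(1 + σ ^ 2) * √(1 + σ ^ 2) = 1 + σ ^ 2 := Real.mul_self_sqrt hpos.le
  have hinner : ⟪(1 / √(1 + σ ^ 2)) • (v + f), (1 / √(1 + σ ^ 2)) • (w + g)⟫ =
      (⟪v, w⟫ + (⟪g, v⟫ + ⟪f, w⟫ + ⟪f, g⟫)) / (1 + σ ^ 2) := by
    rw [real_inner_smul_left, real_inner_smul_right, inner_add_left, inner_add_right,
      inner_add_right, real_inner_comm g v, ← mul_assoc, div_mul_div_comm, hs]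
    ring
  rw [hinner, abs_div, abs_of_pos hpos, le_div_iff₀ hpos]
  have h1 : |⟪v, w⟫| - |⟪g, v⟫ + ⟪f, w⟫ + ⟪f, g⟫| ≤ |⟪v, w⟫ + (⟪g, v⟫ + ⟪f, w⟫ + ⟪f, g⟫)| := by
    have := abs_sub_abs_le_abs_sub ⟪v, w⟫ (-(⟪g, v⟫ + ⟪f, w⟫ + ⟪f, g⟫))
    rwa [abs_neg, sub_neg_eq_add] at this
  have h2 : |⟪g, v⟫ + ⟪f, w⟫ + ⟪f, g⟫| ≤ r * σ + r * σ + r * σ * (σ * 2) :=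
    (abs_add_three _ _ _).trans (by linarith)
  -- The main term is at least `6r(1+σ²)`, and the noise is at most `2rσ + 2rσ² ≤ 3r(1+σ²)`. What
  -- remains exceeds `2.3r(1+σ²)`.
  have h3 : 1 / 10 / √(k : ℝ) = 6 * (1 / 60 / √k) := by ring
  have h4 : r * (2 * σ) ≤ r * (1 + σ ^ 2) := by
    gcongr
    nlinarith [sq_nonneg (σ - 1)]
  nlinarith [mul_nonneg hr (sq_nonneg σ)]

/-- The three noise terms in the inner product of two inliers of one subspace are small with high
probability. -/
theorem noise_tail (hd : ∀ l, 1 ≤ d l) {U : (l : Fin L) → Matrix (Fin m) (Fin (d l)) ℝ}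
    (hU : ∀ l, (U l).transpose * U l = 1) (hσ : 0 ≤ σ) [IsProbabilityMeasure P]
    (h : HasLaw (fun ω => (o ω, a ω, e ω)) (ingredientsLaw m N₀ d n σ) P)
    {N : ℕ} (hN : 0 < N) (hm : 1 ≤ m) (hmN : 6 * log N ≤ m) (l : Fin L) {p j : Fin (n l)}
    (hpj : p ≠ j) :
    P ({ω | √(6 * log N) * √(σ ^ 2 / m) * 1 <
          |⟪e ω l p, (WithLp.toLp 2 ((U l).mulVec (a ω l j).ofLp) : Vec m)⟫|} ∪
        {ω | √(6 * log N) * √(σ ^ 2 / m) * 1 <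
          |⟪e ω l j, (WithLp.toLp 2 ((U l).mulVec (a ω l p).ofLp) : Vec m)⟫|} ∪
        {ω | √(6 * log N) * √(σ ^ 2 / m) * (σ * 2) < |⟪e ω l p, e ω l j⟫|}) ≤
      ENNReal.ofReal (7 / (N : ℝ) ^ 3) := by
  have := isProbabilityMeasure_uniformSphere (hd l)
  have hcross : ∀ p j : Fin (n l), P {ω | √(6 * log N) * √(σ ^ 2 / m) * 1 <
      |⟪e ω l p, (WithLp.toLp 2 ((U l).mulVec (a ω l j).ofLp) : Vec m)⟫|} ≤
      ENNReal.ofReal (2 / (N : ℝ) ^ 3) := by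
    intro p j
    refine (measure_inner_tail (by positivity) (Real.sqrt_nonneg _)
      (hasLaw_noise_coefficient hd h l p j) (measurable_toLp_mulVec (U l))).trans ?_
    rw [two_mul_exp_sqrt hN]
    have h0 : uniformSphere (d l)
        {y | 1 < ‖(WithLp.toLp 2 ((U l).mulVec y.ofLp) : Vec m)‖} = 0 := by
      refine measure_mono_null (fun y hy => ?_) (ae_iff.1 (ae_norm_uniformSphere (d l)))
      rw [Set.mem_ofPred_eq, norm_toLp_mulVec (hU l)] at hy
      exact hy.ne'
    rw [h0, zero_add]
  have hnoise : P {ω | √(6 * log N) * √(σ ^ 2 / m) * (σ * 2) < |⟪e ω l p, e ω l j⟫|} ≤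
      ENNReal.ofReal (1 / (N : ℝ) ^ 3) + ENNReal.ofReal (2 / (N : ℝ) ^ 3) := by
    refine (measure_inner_tail (by positivity) (Real.sqrt_nonneg _)
      (hasLaw_noise_pair hd h l hpj) measurable_id).trans ?_
    rw [two_mul_exp_sqrt hN]
    exact add_le_add_left (isoGaussian_norm_tail_of_log_le hm hN hmN hσ (by norm_num)) _
  -- The 7 is `2 + 2` for the cross terms and `1 + 2` for noise against noise.
  refine (measure_union_le _ _).trans ((add_le_add ((measure_union_le _ _).trans
    (add_le_add (hcross p j) (hcross j p))) hnoise).trans ?_)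
  rw [← ENNReal.ofReal_add (by positivity) (by positivity),
    ← ENNReal.ofReal_add (by positivity) (by positivity),
    ← ENNReal.ofReal_add (by positivity) (by positivity)]
  refine ENNReal.ofReal_le_ofReal (le_of_eq ?_)
  ring

/-- With high probability no inlier of the `l`-th subspace is declared an outlier. -/
theorem inliers_not_declared (hd : ∀ l, 1 ≤ d l)
    {U : (l : Fin L) → Matrix (Fin m) (Fin (d l)) ℝ}
    (hU : ∀ l, (U l).transpose * U l = 1) (hσ : 0 ≤ σ) [IsProbabilityMeasure P]
    (h : HasLaw (fun ω => (o ω, a ω, e ω)) (ingredientsLaw m N₀ d n σ) P)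
    (hdim : ((Finset.univ.sup d : ℕ) : ℝ) / m ≤
      1 / 21600 / ((1 + σ ^ 2) ^ 2 * log (numPoints N₀ n))) (l : Fin L) :
    1 - (n l : ℝ) * (rexp (-(1 / 2) * log (π / 2) * ((n l : ℝ) - 1)) +
        (n l : ℝ) * (7 / (numPoints N₀ n : ℝ) ^ 3)) ≤
      P.real {ω | ∀ j : Fin (n l),
        ¬ DeclaredOutlier (2.3 * √6) (dataPoint U σ (o ω) (a ω) (e ω)) (Sum.inr ⟨l, j⟩)} := by
  set N := numPoints N₀ n with hNdef
  have hnN : n l ≤ N :=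
    (Finset.single_le_sum (fun _ _ => Nat.zero_le _) (Finset.mem_univ l)).trans
      (Nat.le_add_left _ _)
  -- With no inlier the event is everything; with one, the exponential equals 1 and the bound is at
  -- most 0.
  rcases Nat.lt_or_ge (n l) 2 with hn | hn
  · rcases Nat.lt_or_ge (n l) 1 with hn0 | hn1
    · have hnl : n l = 0 := by omega
      have hset : {ω | ∀ j : Fin (n l), ¬ DeclaredOutlier (2.3 * √6)
          (dataPoint U σ (o ω) (a ω) (e ω)) (Sum.inr ⟨l, j⟩)} = Set.univ := by
        ext ω
        simp only [Set.mem_ofPred_eq, Set.mem_univ, iff_true]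
        intro j
        exact absurd j.2 (by omega)
      rw [hset, probReal_univ, hnl]
      simp
    · have hnl : n l = 1 := by omega
      refine le_trans ?_ measureReal_nonneg
      rw [hnl, Nat.cast_one, sub_self, mul_zero, Real.exp_zero]
      have : (0 : ℝ) ≤ 7 / (N : ℝ) ^ 3 := by positivity
      linarith
  have hN : 0 < N := by omega
  have hN2 : (2 : ℝ) ≤ N := by exact_mod_cast hn.trans hnN
  have hlog : 0 < log N := Real.log_pos (by linarith)
  -- For `m = 0` the product `Uᵀ U` would vanish, contradicting orthonormality since `d l ≥ 1`.
  have hm : 1 ≤ m := by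
    rcases Nat.eq_zero_or_pos m with rfl | hm
    · have := congrFun (congrFun (hU l) ⟨0, hd l⟩) ⟨0, hd l⟩
      simp [Matrix.mul_apply] at this
    · exact hm
  have hm0 : (0 : ℝ) < m := by exact_mod_cast hm
  have hdl0 : (1 : ℝ) ≤ d l := by exact_mod_cast hd l
  have hdl : (d l : ℝ) * ((1 + σ ^ 2) ^ 2 * log N) ≤ 1 / 21600 * m := by
    have h1 : (d l : ℝ) ≤ ((Finset.univ.sup d : ℕ) : ℝ) := by
      exact_mod_cast Finset.le_sup (Finset.mem_univ l)
    rw [div_le_div_iff₀ hm0 (by positivity)] at hdim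
    refine le_trans ?_ hdim
    gcongr
  have hmN : 6 * log N ≤ m := by
    have h1 : 1 * (1 ^ 2 * log N) ≤ (d l : ℝ) * ((1 + σ ^ 2) ^ 2 * log N) := by
      gcongr
      nlinarith [sq_nonneg σ]
    linarith
  set r : ℝ := √(6 * log N) / √m with hr
  have hr0 : 0 ≤ r := by positivity
  have hrσ : √(6 * log N) * √(σ ^ 2 / m) = r * σ := by
    rw [Real.sqrt_div (sq_nonneg σ), Real.sqrt_sq hσ, hr]
    ring
  -- Squared, this is `6 (1+σ²)² log N / m ≤ 1/(3600 d)`, that is, the dimension condition with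
  -- constant `1/21600`.
  have hrk : r * (1 + σ ^ 2) ≤ 1 / 60 / √(d l) := by
    refine abs_le_of_sq_le_sq' ?_ (by positivity) |>.2
    rw [hr, mul_pow, div_pow, div_pow, Real.sq_sqrt (by positivity), Real.sq_sqrt hm0.le,
      Real.sq_sqrt (by positivity), div_mul_eq_mul_div, div_le_div_iff₀ hm0 (by positivity)]
    linarith
  have hthr : 2.3 * √6 * √(log N) / √m = 2.3 * r := by
    rw [hr, Real.sqrt_mul (by norm_num)]
    ring
  have hcoef := fun j => (hasLaw_coefficients hd h l).measure_eq
    (p := fun b : Fin (n l) → Vec (d l) => ∀ p, p ≠ j → |⟪b p, b j⟫| < 1 / 10 / √(d l)) (by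
      simp only [Set.ofPred_forall]
      exact MeasurableSet.iInter fun p => MeasurableSet.iInter fun _ =>
        measurableSet_lt (by fun_prop) measurable_const)
  set A : Fin (n l) → Set Ω := fun j =>
    {ω | ∀ p, p ≠ j → |⟪a ω l p, a ω l j⟫| < 1 / 10 / √(d l)} with hA
  set B : Fin (n l) → Fin (n l) → Set Ω := fun j p =>
    {ω | √(6 * log N) * √(σ ^ 2 / m) * 1 <
          |⟪e ω l p, (WithLp.toLp 2 ((U l).mulVec (a ω l j).ofLp) : Vec m)⟫|} ∪
        {ω | √(6 * log N) * √(σ ^ 2 / m) * 1 <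
          |⟪e ω l j, (WithLp.toLp 2 ((U l).mulVec (a ω l p).ofLp) : Vec m)⟫|} ∪
        {ω | √(6 * log N) * √(σ ^ 2 / m) * (σ * 2) < |⟪e ω l p, e ω l j⟫|} with hB
  -- The well-correlated partner `p` of `j` is random, so the noise must be controlled for every
  -- `p`.
  refine one_sub_le_measureReal_of_compl_subset (by positivity)
    (T := ⋃ j : Fin (n l), (A j ∪ ⋃ p : Fin (n l), {ω | p ≠ j ∧ ω ∈ B j p})) ?_ ?_
  · intro ω hω
    by_contra hcon
    refine hω fun j hj => ?_
    simp only [Set.mem_iUnion, Set.mem_union, Set.mem_ofPred_eq, hA, hB, not_exists, not_or,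
      not_and, not_forall, not_lt] at hcon
    obtain ⟨⟨p, hpj, hp⟩, hnoise⟩ := hcon j
    obtain ⟨⟨h1, h2⟩, h3⟩ := hnoise p hpj
    rw [hrσ, mul_one] at h1 h2
    rw [hrσ] at h3
    rw [← inner_toLp_mulVec (hU l)] at hp
    have hge := le_abs_inner_inliers hr0 hrk hp h1 h2 h3
    have hlt := hj (Sum.inr ⟨l, p⟩) (by simpa using hpj)
    rw [card_dataIndex, ← hNdef, hthr] at hlt
    exact absurd hlt (not_lt.2 hge)
  · calc P (⋃ j : Fin (n l), (A j ∪ ⋃ p : Fin (n l), {ω | p ≠ j ∧ ω ∈ B j p}))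
        ≤ ∑ j : Fin (n l), P (A j ∪ ⋃ p : Fin (n l), {ω | p ≠ j ∧ ω ∈ B j p}) :=
          measure_iUnion_fintype_le _ _
      _ ≤ ∑ _j : Fin (n l), (ENNReal.ofReal (rexp (-(1 / 2) * log (π / 2) * ((n l : ℝ) - 1))) +
          ∑ _p : Fin (n l), ENNReal.ofReal (7 / (N : ℝ) ^ 3)) := by
          refine Finset.sum_le_sum fun j _ => (measure_union_le _ _).trans (add_le_add ?_
            ((measure_iUnion_fintype_le _ _).trans (Finset.sum_le_sum fun p _ => ?_)))
          · exact (hcoef j).trans_le (pi_uniformSphere_all_nearly_orthogonal (hd l) j)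
          · by_cases hp : p = j
            · simp [hp]
            · exact (measure_mono fun ω hω => hω.2).trans
                (noise_tail hd hU hσ h hN hm hmN l hp)
      _ = _ := by
          simp only [Finset.sum_const, Finset.card_univ, Fintype.card_fin, nsmul_eq_mul]
          rw [← ENNReal.ofReal_natCast, ← ENNReal.ofReal_mul (by positivity),
            ← ENNReal.ofReal_add (by positivity) (by positivity),
            ← ENNReal.ofReal_mul (by positivity)]

end Model

theorem theorem2 :
    ∃ c₁ : ℝ, 0 < c₁ ∧
      ∀ (m L N₀ : ℕ) (d n : Fin L → ℕ) (_ : ∀ l, 1 ≤ d l)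
        (U : (l : Fin L) → Matrix (Fin m) (Fin (d l)) ℝ)
        (_ : ∀ l, (U l).transpose * U l = 1)
        (σ : ℝ) (_ : 0 ≤ σ)
        (Ω : Type*) (_ : MeasurableSpace Ω) (P : Measure Ω) (_ : IsProbabilityMeasure P)
        (o : Ω → Fin N₀ → Vec m)
        (a : Ω → (l : Fin L) → Fin (n l) → Vec (d l))
        (e : Ω → (l : Fin L) → Fin (n l) → Vec m)
        (_ : HasLaw (fun ω => (o ω, a ω, e ω)) (ingredientsLaw m N₀ d n σ) P),
        (6 * Real.log (numPoints N₀ n) ≤ m →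
          1 - 3 * ((N₀ : ℝ) / (numPoints N₀ n : ℝ) ^ 2) ≤
            P.real {ω | ∀ i : Fin N₀,
              DeclaredOutlier (2.3 * √6) (dataPoint U σ (o ω) (a ω) (e ω)) (Sum.inl i)}) ∧
        (((Finset.univ.sup d : ℕ) : ℝ) / m ≤
            c₁ / ((1 + σ ^ 2) ^ 2 * Real.log (numPoints N₀ n)) →
          ∀ l : Fin L,
            1 - (n l : ℝ) * (Real.exp (-(1 / 2) * Real.log (Real.pi / 2) * ((n l : ℝ) - 1)) +
                (n l : ℝ) * (7 / (numPoints N₀ n : ℝ) ^ 3)) ≤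
              P.real {ω | ∀ j : Fin (n l),
                ¬ DeclaredOutlier (2.3 * √6) (dataPoint U σ (o ω) (a ω) (e ω))
                  (Sum.inr ⟨l, j⟩)}) := by
  -- `21600 = 6 * 60²`: the 6 comes from `√(6 log N)`, the 60 from asking the main term `1/(10√d)`
  -- to be six times `r(1+σ²)`.
  refine ⟨1 / 21600, by norm_num, ?_⟩
  intro m L N₀ d n hd U hU σ hσ Ω _ P _ o a e h
  exact ⟨outliers_detected hd hU hσ h, fun hdim l => inliers_not_declared hd hU hσ h hdim l⟩
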